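/- **Model.** Let $\theta=(\mu_0,\mu_1,\Sigma,\alpha)$ with $\mu_0,\mu_1\in\mathbb R^d$, $\Sigma\in\mathbb R^{d\times d}$ positive definite and $\alpha\in[0,1]$. Let $P_\theta$ be the law of $(Y,X)\in\{0,1\}\times\mathbb R^d$ generated as follows: the true label $Z$ is uniform on $\{0,1\}$; given $Z=z$, the covariate $X\sim N(\mu_z,\Sigma)$ and the observed label $Y$ are independent, with $P(Y=z)=(1+\alpha)/2$ and $P(Y=1-z)=(1-\alpha)/2$ (the label is replaced by a uniform one with probability $1-\alpha$). Let $P_\theta^n$ be the law of $n$ i.i.d. copies. For $\gamma\ge 0$ and $s\in\mathbb N$ put $$\mathcal G_0(\Sigma)=\{(\mu,\mu,\Sigma,\alpha):\mu\in\mathbb R^d\},$$ $$\mathcal G_1(\Sigma;\gamma)=\{(\mu_0,\mu_1,\Sigma,\alpha):\ \|\mu_0-\mu_1\|_0\le s,\ (\mu_0-\mu_1)^\top\Sigma^{-1}(\mu_0-\mu_1)\ge\gamma\},$$ where $\|v\|_0$ is the number of nonzero entries of $v$, and define the minimax testing risk $$R_n^*[\mathcal G_0,\mathcal G_1]=\inf_\phi\Big\{\sup_{\theta\in\mathcal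 G_0}P_\theta^n(\phi=1)+\sup_{\theta\in\mathcal G_1}P_\theta^n(\phi=0)\Big\},$$ the infimum being over all measurable tests $\phi:(\{0,1\}\times\mathbb R^d)^n\to\{0,1\}$ (which may depend on $\Sigma$, $\alpha$, $s$ and $\gamma$). **Theorem.** Let $d=d_n\ge 1$ and $s=s_n\ge 0$ be integers and let $\alpha=\alpha_n\in[0,1]$, all indexed by the sample size $n$, and suppose that $s=o(d^{1/2-\delta})$ as $n\to\infty$ for some constant $\delta>0$. Let $$\gamma_n^*=\sqrt{\frac{s\log d}{n}}\ \wedge\ \Big(\frac1{\alpha^2}\cdot\frac{s\log d}{n}\Big),$$ where $\gamma_n^*=\sqrt{s\log d/n}$ when $\alpha=0$. Then for every nonnegative sequence $(\gamma_n)$ with $\gamma_n=o(\gamma_n^*)$, every test is asymptotically powerless: $$\lim_{n\to\infty}\ \sup_{\Sigma}\ R_n^*[\mathcal G_0(\Sigma),\mathcal G_1(\Sigma;\gamma_n)]=1,$$ the supremum being over all positive definite $\Sigma\in\mathbb R^{d\times d}$. Here $a_n=o(b_n)$ means that for every $\varepsilon>0$, $|a_n|\le\varepsilon|b_n|$ for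 all large $n$. -/

import Mathlib

open MeasureTheory ProbabilityTheory Filter Asymptotics
open scoped ENNReal Topology Matrix

namespace WeakSup

/-- The parameter `θ = (μ₀, μ₁, Σ, α)` of the weakly supervised model in dimension `d`:
`mean z` is the mean of the class with true label `z`. -/
structure Param (d : ℕ) where
  mean : Fin 2 → EuclideanSpace ℝ (Fin d)
  cov : Matrix (Fin d) (Fin d) ℝ
  alpha : ℝ

/-- Conditional law of the observed label `Y` given the true label `Z = z`:
`P(Y = z) = (1 + α) / 2` and `P(Y = 1 - z) = (1 - α) / 2`, for `α ∈ [0, 1]`. -/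
noncomputable def labelLaw (α : ℝ) (z : Fin 2) : Measure (Fin 2) :=
  ENNReal.ofReal ((1 + α) / 2) • Measure.dirac z +
    ENNReal.ofReal ((1 - α) / 2) • Measure.dirac (1 - z)

/-- Law `P_θ` of one observation `(Y, X)`: the true label `Z` is uniform on `{0, 1}` and, given
`Z = z`, the observed label `Y` and the covariate `X ∼ N(μ_z, Σ)` are independent. -/
noncomputable def obsLaw {d : ℕ} (θ : Param d) :
    Measure (Fin 2 × EuclideanSpace ℝ (Fin d)) :=
  ∑ z : Fin 2, (2⁻¹ : ℝ≥0∞) •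
    (labelLaw θ.alpha z).prod (multivariateGaussian (θ.mean z) θ.cov)

/-- Law `P_θ^n` of `n` independent observations. -/
noncomputable def sampleLaw {d : ℕ} (n : ℕ) (θ : Param d) :
    Measure (Fin n → Fin 2 × EuclideanSpace ℝ (Fin d)) :=
  Measure.pi fun _ => obsLaw θ

/-- Testing risk of `φ` (the value `1` rejects the null): the supremum over `G₀` of the type-I
error plus the supremum over `G₁` of the type-II error. -/
noncomputable def risk {d n : ℕ} (φ : (Fin n → Fin 2 × EuclideanSpace ℝ (Fin d)) → Fin 2)
    (G₀ G₁ : Set (Param d)) : ℝ≥0∞ :=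
  (⨆ θ ∈ G₀, sampleLaw n θ {x | φ x = 1}) + ⨆ θ ∈ G₁, sampleLaw n θ {x | φ x = 0}

/-- Minimax risk: the infimum of the testing risk over all measurable tests. -/
noncomputable def minimaxRisk {d : ℕ} (n : ℕ) (G₀ G₁ : Set (Param d)) : ℝ≥0∞ :=
  ⨅ (φ : (Fin n → Fin 2 × EuclideanSpace ℝ (Fin d)) → Fin 2) (_ : Measurable φ), risk φ G₀ G₁

/-- The signal-to-noise ratio `(μ₀ - μ₁)ᵀ Σ⁻¹ (μ₀ - μ₁)`. -/
noncomputable def snr {d : ℕ} (θ : Param d) : ℝ :=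
  (θ.mean 0 - θ.mean 1).ofLp ⬝ᵥ (θ.cov⁻¹ *ᵥ (θ.mean 0 - θ.mean 1).ofLp)

/-- The null parameter space: equal means, known covariance `S` and supervision level `α`. -/
def nullSpace {d : ℕ} (S : Matrix (Fin d) (Fin d) ℝ) (α : ℝ) : Set (Param d) :=
  {θ | θ.mean 0 = θ.mean 1 ∧ θ.cov = S ∧ θ.alpha = α}

/-- The alternative parameter space: the difference of the means has at most `s` nonzero entries
and the signal-to-noise ratio is at least `γ`; `S` and `α` are as under the null. -/
def altSpace {d : ℕ} (S : Matrix (Fin d) (Fin d) ℝ) (α : ℝ) (s : ℕ) (γ : ℝ) : Set (Param d) :=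
  {θ | hammingNorm (θ.mean 0 - θ.mean 1).ofLp ≤ s ∧ γ ≤ snr θ ∧ θ.cov = S ∧ θ.alpha = α}

/-- The rate `√(s log d / n) ∧ (1 / α² · s log d / n)`. For `α = 0` the second term is `+∞`, so
that the minimum is the first term. -/
noncomputable def rate (n d s : ℕ) (α : ℝ) : ℝ :=
  if α = 0 then √(s * Real.log d / n)
  else min √(s * Real.log d / n) (1 / α ^ 2 * (s * Real.log d / n))

end WeakSup

/-!
The minimax risk never exceeds `1`, the risk of the test that always rejects. For the lower bound,
the supremum over covariance matrices is bounded below by its value at the identity, where the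
second-moment method of Ingster applies (`one_sub_le_minimaxRisk`): the null with both means `0` is
tested against a finite uniform mixture of alternatives with means `m` and `-m`, and if the
likelihood ratio `L` of the mixture satisfies `E L² ≤ 1 + ε²`, then every test has risk at least
`1 - ε`.

With respect to the null, one observation from the alternative `m` has density
`exp (-‖m‖² / 2) * (cosh ⟪m, x⟫ ± α * sinh ⟪m, x⟫)`, the sign being that of the label, so two
alternatives `m`, `w` have the one-observation correlation
`cosh ⟪m, w⟫ + α² * sinh ⟪m, w⟫ ≤ exp (⟪m, w⟫² / 2 + α² * ⟪m, w⟫)` when `⟪m, w⟫ ≥ 0`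
(`integrable_and_integral_obsDensity_mul`, `cosh_add_mul_sinh_le_exp`). The two terms of the
exponent are the two regimes of the rate: `n * ⟪m, w⟫²` is controlled by the square-root
term, and `n * α² * ⟪m, w⟫` by the other one.

The prior cuts `s * b` of the `d` coordinates, `b = ⌊d / s⌋`, into `s` blocks of length `b` and
puts a nonzero entry at an independent uniform position of each block. The inner product of two
such means is proportional to the number `K` of blocks in which they agree, which is
`Bin (s, 1 / b)`, and if `γ ≤ η * rate` then `E L² ≤ E (d ^ η) ^ K ≤ exp (s * d ^ η / b)`
(`exponent_le`, `sum_pow_agreements_le`). As `s / b ≤ 2 s² / d` and `s ≤ η * d ^ (1 / 2 - δ)`, this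
is at most `exp (2 η²)` for `η ≤ 2 δ` (`sq_mul_rpow_div_le`); this is where sparsity below `√d`
enters.
-/

namespace WeakSup

/-! ### Densities of products and of Gaussian shifts -/

/-- The product of measures with densities `g i` has density `∏ i, g i (x i)` with respect to the
product of the reference measures. -/
lemma pi_withDensity_ofReal {ι : Type*} [Fintype ι] {X : ι → Type*}
    [∀ i, MeasurableSpace (X i)] (μ : ∀ i, Measure (X i)) [∀ i, SigmaFinite (μ i)]
    (g : ∀ i, X i → ℝ) (hg0 : ∀ i x, 0 ≤ g i x) (hg : ∀ i, Integrable (g i) (μ i)) :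
    Measure.pi (fun i => (μ i).withDensity fun x => ENNReal.ofReal (g i x)) =
      (Measure.pi μ).withDensity fun x => ENNReal.ofReal (∏ i, g i (x i)) := by
  have hfin : ∀ i, IsFiniteMeasure ((μ i).withDensity fun x => ENNReal.ofReal (g i x)) :=
    fun i => isFiniteMeasure_withDensity_ofReal (hg i).2
  refine Measure.pi_eq fun s hs => ?_
  rw [withDensity_apply _ (MeasurableSet.univ_pi hs), Measure.restrict_pi_pi,
    ← ofReal_integral_eq_lintegral_ofReal
      (Integrable.fintype_prod_dep fun i => (hg i).restrict)
      (ae_of_all _ fun x => Finset.prod_nonneg fun i _ => hg0 i _),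
    integral_fintype_prod_eq_prod,
    ENNReal.ofReal_prod_of_nonneg fun i _ => integral_nonneg (hg0 i)]
  refine Finset.prod_congr rfl fun i _ => ?_
  rw [withDensity_apply _ (hs i), ofReal_integral_eq_lintegral_ofReal (hg i).restrict
    (ae_of_all _ (hg0 i))]

lemma gaussianReal_one_eq_withDensity (m : ℝ) :
    gaussianReal m 1 = (gaussianReal 0 1).withDensity
      fun x => ENNReal.ofReal (Real.exp (m * x - m ^ 2 / 2)) := by
  rw [gaussianReal_of_var_ne_zero _ one_ne_zero, gaussianReal_of_var_ne_zero _ one_ne_zero,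
    ← withDensity_mul _ (measurable_gaussianPDF 0 1) (by fun_prop)]
  congr 1
  ext x
  rw [Pi.mul_apply, gaussianPDF, gaussianPDF, ← ENNReal.ofReal_mul (gaussianPDFReal_nonneg _ _ _)]
  congr 1
  simp only [gaussianPDFReal, mul_assoc, ← Real.exp_add]
  congr 3
  push_cast
  ring

lemma integrable_exp_gaussianReal (m : ℝ) :
    Integrable (fun x => Real.exp (m * x - m ^ 2 / 2)) (gaussianReal 0 1) := by
  simp_rw [Real.exp_sub]
  exact (integrable_exp_mul_gaussianReal m).div_const _

/-- The density of `N(m, I)` with respect to `N(0, I)`, see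
`multivariateGaussian_one_eq_withDensity`. -/
noncomputable def expTilt {d : ℕ} (m x : EuclideanSpace ℝ (Fin d)) : ℝ :=
  Real.exp (inner ℝ m x - ‖m‖ ^ 2 / 2)

lemma expTilt_nonneg {d : ℕ} (m x : EuclideanSpace ℝ (Fin d)) : 0 ≤ expTilt m x :=
  (Real.exp_pos _).le

lemma measurable_expTilt {d : ℕ} (m : EuclideanSpace ℝ (Fin d)) : Measurable (expTilt m) := by
  unfold expTilt
  fun_prop

lemma expTilt_toLp {d : ℕ} (m : EuclideanSpace ℝ (Fin d)) (x : Fin d → ℝ) :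
    expTilt m (WithLp.toLp 2 x) = ∏ i, Real.exp (m i * x i - m i ^ 2 / 2) := by
  rw [expTilt, ← Real.exp_sum, EuclideanSpace.real_norm_sq_eq, PiLp.inner_apply,
    Finset.sum_sub_distrib, Finset.sum_div]
  simp [mul_comm]

lemma multivariateGaussian_one_eq_withDensity {d : ℕ} (m : EuclideanSpace ℝ (Fin d)) :
    multivariateGaussian m 1 = (stdGaussian (EuclideanSpace ℝ (Fin d))).withDensity
      fun x => ENNReal.ofReal (expTilt m x) := by
  have h1 : multivariateGaussian m 1 =
      (Measure.pi fun i => gaussianReal (m i) 1).map (WithLp.toLp 2) := by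
    have h2 : (fun i : Fin d => gaussianReal (m i) 1) =
        fun i => (gaussianReal 0 1).map (m i + ·) := by
      ext1 i
      rw [gaussianReal_map_const_add, zero_add]
    rw [h2, ← Measure.pi_map_pi (μ := fun _ : Fin d => gaussianReal 0 1)
        (f := fun i x => m i + x) (fun i => by fun_prop), Measure.map_map (by fun_prop) (by fun_prop),
      multivariateGaussian, ← map_pi_eq_stdGaussian, Measure.map_map (by fun_prop) (by fun_prop)]
    congr 1
    ext x i
    simp
  ext A hA
  rw [h1, withDensity_apply _ hA, ← map_pi_eq_stdGaussian,
    setLIntegral_map hA (measurable_expTilt m).ennreal_ofReal (by fun_prop),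
    Measure.map_apply (by fun_prop) hA]
  simp_rw [gaussianReal_one_eq_withDensity (m _)]
  rw [pi_withDensity_ofReal _ _ (fun _ _ => (Real.exp_pos _).le)
    (fun i => integrable_exp_gaussianReal _), withDensity_apply _ (by measurability)]
  simp_rw [expTilt_toLp]

lemma integrable_and_integral_expTilt {d : ℕ} (m : EuclideanSpace ℝ (Fin d)) :
    Integrable (expTilt m) (stdGaussian _) ∧ ∫ x, expTilt m x ∂(stdGaussian _) = 1 := by
  have h : ∫⁻ x, ENNReal.ofReal (expTilt m x) ∂(stdGaussian _) = 1 := by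
    have := congrArg (· Set.univ) (multivariateGaussian_one_eq_withDensity m)
    simpa using this.symm
  have hi : Integrable (expTilt m) (stdGaussian _) := by
    refine ⟨(measurable_expTilt m).aestronglyMeasurable, ?_⟩
    rw [hasFiniteIntegral_iff_ofReal (ae_of_all _ (expTilt_nonneg m)), h]
    simp
  refine ⟨hi, ?_⟩
  rw [integral_eq_lintegral_of_nonneg_ae (ae_of_all _ (expTilt_nonneg m)) hi.1, h]
  simp

/-- The normalizing constants of the exponential tilts by `m`, `w` and `m + w` differ by the factor
`exp ⟪m, w⟫`, which makes this the correlation of the first two. -/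
lemma expTilt_mul {d : ℕ} (m w x : EuclideanSpace ℝ (Fin d)) :
    expTilt m x * expTilt w x = Real.exp (inner ℝ m w) * expTilt (m + w) x := by
  simp only [expTilt, ← Real.exp_add]
  congr 1
  rw [inner_add_left, norm_add_sq_real]
  ring

/-! ### The law of one observation -/

/-- The uniform law on the two labels. -/
noncomputable def uniformLabel : Measure (Fin 2) :=
  (2⁻¹ : ℝ≥0∞) • (Measure.dirac 0 + Measure.dirac 1)

instance : IsProbabilityMeasure uniformLabel :=
  ⟨by simp [uniformLabel, ENNReal.inv_two_add_inv_two]⟩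

/-- The sign attached to a label: `1` for the label `0` and `-1` for the label `1`. -/
def labelSign : Fin 2 → ℝ := ![1, -1]

lemma integral_uniformLabel (f : Fin 2 → ℝ) : ∫ y, f y ∂uniformLabel = (f 0 + f 1) / 2 := by
  rw [uniformLabel, integral_smul_measure, integral_add_measure (by simp)
    (by simp), integral_dirac, integral_dirac]
  simp
  ring

/-- No condition on `α` is needed: `ENNReal.ofReal` truncates both sides in the same way. -/
lemma labelLaw_eq_withDensity (α : ℝ) (z : Fin 2) :
    labelLaw α z = uniformLabel.withDensity
      fun y => ENNReal.ofReal (1 + α * labelSign z * labelSign y) := by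
  have hU : ∀ y, uniformLabel {y} = ENNReal.ofReal (1 / 2) := by
    have h2 : ENNReal.ofReal (1 / 2) = 2⁻¹ := by
      rw [one_div, ENNReal.ofReal_inv_of_pos two_pos]; simp
    intro y
    rw [h2]
    fin_cases y <;> simp [uniformLabel]
  refine Measure.ext_of_singleton fun y => ?_
  rw [withDensity_apply _ (measurableSet_singleton y), lintegral_singleton, hU,
    ← ENNReal.ofReal_mul' (by norm_num)]
  fin_cases z <;> fin_cases y <;> simp [labelLaw, labelSign] <;> congr 1

/-- The parameter with identity covariance whose class means are `m` (for `z = 0`) and `-m` (for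
`z = 1`). -/
noncomputable def oppositeMeans {d : ℕ} (α : ℝ) (m : EuclideanSpace ℝ (Fin d)) : Param d :=
  ⟨fun z => labelSign z • m, 1, α⟩

/-- Law of one observation when both means are `0` and the covariance is the identity: the label
is uniform and independent of the standard Gaussian covariate, whatever the value of `α`. -/
noncomputable def nullObs (d : ℕ) : Measure (Fin 2 × EuclideanSpace ℝ (Fin d)) :=
  uniformLabel.prod (stdGaussian _)

instance (d : ℕ) : IsProbabilityMeasure (nullObs d) := by unfold nullObs; infer_instance

/-- The density of the law of one observation with means `m` and `-m` with respect to `nullObs`,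
as an average over the true label `z`, see `obsLaw_eq_withDensity`. -/
noncomputable def obsDensity {d : ℕ} (α : ℝ) (m : EuclideanSpace ℝ (Fin d))
    (p : Fin 2 × EuclideanSpace ℝ (Fin d)) : ℝ :=
  ∑ z, 2⁻¹ * ((1 + α * labelSign z * labelSign p.1) * expTilt (labelSign z • m) p.2)

lemma labelWeight_nonneg {α : ℝ} (hα : α ∈ Set.Icc (0 : ℝ) 1) (z y : Fin 2) :
    0 ≤ 1 + α * labelSign z * labelSign y := by
  obtain ⟨h0, h1⟩ := hα
  fin_cases z <;> fin_cases y <;> simp [labelSign] <;> linarith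

lemma obsDensity_nonneg {d : ℕ} {α : ℝ} (hα : α ∈ Set.Icc (0 : ℝ) 1)
    (m : EuclideanSpace ℝ (Fin d)) (p : Fin 2 × EuclideanSpace ℝ (Fin d)) :
    0 ≤ obsDensity α m p :=
  Finset.sum_nonneg fun z _ => mul_nonneg (by norm_num)
    (mul_nonneg (labelWeight_nonneg hα z _) (expTilt_nonneg _ _))

lemma obsLaw_eq_withDensity {d : ℕ} {α : ℝ} (hα : α ∈ Set.Icc (0 : ℝ) 1)
    (m : EuclideanSpace ℝ (Fin d)) :
    obsLaw (oppositeMeans α m) =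
      (nullObs d).withDensity fun p => ENNReal.ofReal (obsDensity α m p) := by
  have hmeas : ∀ z : Fin 2, Measurable fun p : Fin 2 × EuclideanSpace ℝ (Fin d) =>
      ENNReal.ofReal (1 + α * labelSign z * labelSign p.1) *
        ENNReal.ofReal (expTilt (labelSign z • m) p.2) := fun z =>
    ((measurable_of_finite fun y : Fin 2 =>
      ENNReal.ofReal (1 + α * labelSign z * labelSign y)).comp measurable_fst).mul
      ((measurable_expTilt _).ennreal_ofReal.comp measurable_snd)
  have hdens : (fun p => ENNReal.ofReal (obsDensity α m p)) = fun p => ∑ z : Fin 2,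
      2⁻¹ * (ENNReal.ofReal (1 + α * labelSign z * labelSign p.1) *
        ENNReal.ofReal (expTilt (labelSign z • m) p.2)) := by
    ext p
    rw [obsDensity, ENNReal.ofReal_sum_of_nonneg fun z _ => mul_nonneg (by norm_num)
      (mul_nonneg (labelWeight_nonneg hα z _) (expTilt_nonneg _ _))]
    refine Finset.sum_congr rfl fun z _ => ?_
    rw [ENNReal.ofReal_mul (by norm_num), ENNReal.ofReal_mul (labelWeight_nonneg hα z _),
      ENNReal.ofReal_inv_of_pos two_pos]
    simp
  ext A hA
  rw [withDensity_apply _ hA, hdens, lintegral_finsetSum _ fun z _ => (hmeas z).const_mul _,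
    obsLaw, Measure.finsetSum_apply]
  refine Finset.sum_congr rfl fun z _ => ?_
  rw [lintegral_const_mul _ (hmeas z), oppositeMeans, labelLaw_eq_withDensity α,
    multivariateGaussian_one_eq_withDensity, Measure.smul_apply, smul_eq_mul]
  have := prod_withDensity (μ := uniformLabel) (ν := stdGaussian (EuclideanSpace ℝ (Fin d)))
    (measurable_of_finite fun y : Fin 2 => ENNReal.ofReal (1 + α * labelSign z * labelSign y))
    (measurable_expTilt (labelSign z • m)).ennreal_ofReal
  rw [this, withDensity_apply _ hA, nullObs]

/-- The correlation of two alternatives. The cross terms in `cosh` and `sinh` vanish because the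
label is symmetric under the null, so that `α` enters only through `α ^ 2`. -/
lemma integrable_and_integral_obsDensity_mul {d : ℕ} (α : ℝ) (m w : EuclideanSpace ℝ (Fin d)) :
    Integrable (fun p => obsDensity α m p * obsDensity α w p) (nullObs d) ∧
    ∫ p, obsDensity α m p * obsDensity α w p ∂(nullObs d) =
      Real.cosh (inner ℝ m w) + α ^ 2 * Real.sinh (inner ℝ m w) := by
  have hexp : ∀ p, obsDensity α m p * obsDensity α w p = ∑ z : Fin 2, ∑ z' : Fin 2,
      (4⁻¹ * Real.exp (inner ℝ (labelSign z • m) (labelSign z' • w))) *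
        (((1 + α * labelSign z * labelSign p.1) * (1 + α * labelSign z' * labelSign p.1)) *
        expTilt (labelSign z • m + labelSign z' • w) p.2) := by
    intro p
    rw [obsDensity, obsDensity, Finset.sum_mul_sum]
    refine Finset.sum_congr rfl fun z _ => Finset.sum_congr rfl fun z' _ => ?_
    linear_combination (4⁻¹ * (1 + α * labelSign z * labelSign p.1) *
      (1 + α * labelSign z' * labelSign p.1)) * expTilt_mul (labelSign z • m) (labelSign z' • w) p.2
  have hint : ∀ z z' : Fin 2, Integrable (fun p : Fin 2 × EuclideanSpace ℝ (Fin d) =>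
      (4⁻¹ * Real.exp (inner ℝ (labelSign z • m) (labelSign z' • w))) *
        (((1 + α * labelSign z * labelSign p.1) * (1 + α * labelSign z' * labelSign p.1)) *
        expTilt (labelSign z • m + labelSign z' • w) p.2)) (nullObs d) := fun z z' =>
    (Integrable.mul_prod (μ := uniformLabel) (f := fun y : Fin 2 =>
      (1 + α * labelSign z * labelSign y) * (1 + α * labelSign z' * labelSign y))
      (Integrable.of_finite) (integrable_and_integral_expTilt _).1).const_mul _
  simp_rw [hexp]
  refine ⟨integrable_finsetSum _ fun z _ => integrable_finsetSum _ fun z' _ => hint z z', ?_⟩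
  rw [integral_finsetSum _ fun z _ => integrable_finsetSum _ fun z' _ => hint z z']
  simp_rw [integral_finsetSum _ fun z' _ => hint _ z', integral_const_mul, nullObs]
  have h : ∀ z z' : Fin 2, ∫ p : Fin 2 × EuclideanSpace ℝ (Fin d),
      ((1 + α * labelSign z * labelSign p.1) * (1 + α * labelSign z' * labelSign p.1)) *
        expTilt (labelSign z • m + labelSign z' • w) p.2 ∂(uniformLabel.prod (stdGaussian _)) =
      1 + α ^ 2 * labelSign z * labelSign z' := by
    intro z z'
    rw [integral_prod_mul (fun y : Fin 2 => (1 + α * labelSign z * labelSign y) *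
      (1 + α * labelSign z' * labelSign y)), (integrable_and_integral_expTilt _).2,
      integral_uniformLabel]
    simp [labelSign]
    ring
  simp_rw [h, inner_smul_left, inner_smul_right]
  simp [labelSign, Fin.sum_univ_two, Real.cosh_eq, Real.sinh_eq]
  ring

lemma obsLaw_oppositeMeans_zero {d : ℕ} {α : ℝ} (hα : α ∈ Set.Icc (0 : ℝ) 1) :
    obsLaw (oppositeMeans α (0 : EuclideanSpace ℝ (Fin d))) = nullObs d := by
  rw [obsLaw_eq_withDensity hα]
  have : (fun p : Fin 2 × EuclideanSpace ℝ (Fin d) =>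
      ENNReal.ofReal (obsDensity α 0 p)) = 1 := by
    ext p
    have : obsDensity α 0 p = 1 := by
      simp [obsDensity, expTilt, labelSign, Fin.sum_univ_two]
      ring
    simp [this]
  rw [this, withDensity_one]

lemma integrable_and_integral_obsDensity {d : ℕ} {α : ℝ} (m : EuclideanSpace ℝ (Fin d)) :
    Integrable (obsDensity α m) (nullObs d) ∧ ∫ p, obsDensity α m p ∂(nullObs d) = 1 := by
  have h0 : ∀ p, obsDensity α (0 : EuclideanSpace ℝ (Fin d)) p = 1 := by
    intro p
    simp [obsDensity, expTilt, labelSign, Fin.sum_univ_two]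
    ring
  simpa [h0] using integrable_and_integral_obsDensity_mul α m 0

/-! ### The second-moment method -/

/-- A test between `P` and the measure with density `L` with respect to `P` has total error at
least `1 - ε` if the chi-square divergence of the two is at most `ε ^ 2`. -/
lemma one_sub_le_testing_error {Ω : Type*} [MeasurableSpace Ω] {P : Measure Ω}
    [IsProbabilityMeasure P] {L : Ω → ℝ} (hL0 : ∀ x, 0 ≤ L x) (hL : Integrable L P)
    (hL1 : ∫ x, L x ∂P = 1) (hL2 : Integrable (fun x => L x ^ 2) P) {ε : ℝ} (hε : 0 < ε)
    (hchi : ∫ x, L x ^ 2 ∂P ≤ 1 + ε ^ 2) {A : Set Ω} (hA : MeasurableSet A) :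
    ENNReal.ofReal (1 - ε) ≤ P A + P.withDensity (fun x => ENNReal.ofReal (L x)) Aᶜ := by
  have hint : Integrable (fun x => 1 - ((L x ^ 2 - 2 * L x + 1) / ε + ε) / 2) P := by
    fun_prop
  have hlow : 1 - ε ≤ ∫ x, 1 - ((L x ^ 2 - 2 * L x + 1) / ε + ε) / 2 ∂P := by
    have : ∫ x, 1 - ((L x ^ 2 - 2 * L x + 1) / ε + ε) / 2 ∂P =
        1 - ((∫ x, L x ^ 2 ∂P - 1) / ε + ε) / 2 := by
      rw [integral_sub (by fun_prop) (by fun_prop), integral_div, integral_add (by fun_prop)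
        (by fun_prop), integral_div, integral_add (by fun_prop) (by fun_prop),
        integral_sub (by fun_prop) (by fun_prop), integral_const_mul, hL1]
      simp
      ring
    rw [this]
    have : (∫ x, L x ^ 2 ∂P - 1) / ε ≤ ε := by
      rw [div_le_iff₀ hε]
      linarith
    linarith
  have hone : Integrable (A.indicator (1 : Ω → ℝ)) P := (integrable_const (1 : ℝ)).indicator hA
  have hrhs : P A + P.withDensity (fun x => ENNReal.ofReal (L x)) Aᶜ =
      ENNReal.ofReal (∫ x, A.indicator 1 x + Aᶜ.indicator L x ∂P) := by
    rw [integral_add hone (hL.indicator hA.compl),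
      integral_indicator hA.compl, ENNReal.ofReal_add
        (integral_nonneg fun x => Set.indicator_nonneg (by simp) x)
        (integral_nonneg fun x => hL0 x), integral_indicator_one hA, withDensity_apply _ hA.compl,
      ofReal_integral_eq_lintegral_ofReal hL.integrableOn (ae_of_all _ hL0)]
    simp
  rw [hrhs]
  refine ENNReal.ofReal_le_ofReal (hlow.trans (integral_mono hint
    (hone.add (hL.indicator hA.compl)) fun x => ?_))
  -- The Cauchy-Schwarz bound for `∫ |L - 1|`, in its pointwise form
  -- `|L - 1| ≤ ((L - 1) ^ 2 / ε + ε) / 2`.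
  have key : 1 - L x ≤ ((L x ^ 2 - 2 * L x + 1) / ε + ε) / 2 := by
    rw [le_div_iff₀ two_pos, div_add' _ _ _ hε.ne', le_div_iff₀ hε]
    nlinarith [sq_nonneg (L x - 1 + ε)]
  have hpos : 0 ≤ ((L x ^ 2 - 2 * L x + 1) / ε + ε) / 2 := by
    have : 0 ≤ L x ^ 2 - 2 * L x + 1 := by nlinarith [sq_nonneg (L x - 1)]
    positivity
  by_cases hx : x ∈ A
  · simpa [hx] using hpos
  · simp only [hx, Set.indicator_of_notMem, not_false_eq_true, Set.mem_compl_iff,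
      Set.indicator_of_mem, zero_add]
    linarith

lemma sampleLaw_eq_withDensity {d : ℕ} (n : ℕ) {α : ℝ} (hα : α ∈ Set.Icc (0 : ℝ) 1)
    (m : EuclideanSpace ℝ (Fin d)) :
    sampleLaw n (oppositeMeans α m) = (Measure.pi fun _ : Fin n => nullObs d).withDensity
      fun x => ENNReal.ofReal (∏ k, obsDensity α m (x k)) := by
  rw [sampleLaw, obsLaw_eq_withDensity hα]
  exact pi_withDensity_ofReal (fun _ : Fin n => nullObs d) (fun _ => obsDensity α m)
    (fun _ => obsDensity_nonneg hα m) fun _ => (integrable_and_integral_obsDensity m).1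

/-- The second-moment method: the minimax risk is at least `1 - ε` if `G₁` contains the finitely
many alternatives `m i` and the likelihood ratio of their uniform mixture has second moment at most
`1 + ε ^ 2` under the null. -/
lemma one_sub_le_minimaxRisk {d n : ℕ} {α : ℝ} (hα : α ∈ Set.Icc (0 : ℝ) 1)
    {ι : Type*} [Fintype ι] [Nonempty ι] (m : ι → EuclideanSpace ℝ (Fin d))
    {G₀ G₁ : Set (Param d)} (h₀ : oppositeMeans α 0 ∈ G₀) (h₁ : ∀ i, oppositeMeans α (m i) ∈ G₁)
    {ε : ℝ} (hε : 0 < ε)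
    (hchi : ∑ i, ∑ j, (Real.cosh (inner ℝ (m i) (m j)) +
      α ^ 2 * Real.sinh (inner ℝ (m i) (m j))) ^ n ≤ (Fintype.card ι : ℝ) ^ 2 * (1 + ε ^ 2)) :
    ENNReal.ofReal (1 - ε) ≤ minimaxRisk n G₀ G₁ := by
  refine le_iInf₂ fun φ hφ => ?_
  set P : Measure (Fin n → Fin 2 × EuclideanSpace ℝ (Fin d)) :=
    Measure.pi fun _ => nullObs d with hP
  set c : ℝ := (Fintype.card ι : ℝ) with hc
  have hc0 : 0 < c := Nat.cast_pos.2 Fintype.card_pos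
  set f : ι → (Fin n → Fin 2 × EuclideanSpace ℝ (Fin d)) → ℝ :=
    fun i x => ∏ k, obsDensity α (m i) (x k) with hf
  have hf0 : ∀ i x, 0 ≤ f i x := fun i x =>
    Finset.prod_nonneg fun k _ => obsDensity_nonneg hα _ _
  have hfi : ∀ i, Integrable (f i) P := fun i =>
    Integrable.fintype_prod fun _ => (integrable_and_integral_obsDensity (m i)).1
  have hf1 : ∀ i, ∫ x, f i x ∂P = 1 := fun i => by
    simp only [hf, hP]
    rw [integral_fintype_prod_eq_prod (fun _ => obsDensity α (m i))]
    simp [(integrable_and_integral_obsDensity (m i)).2]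
  have hff : ∀ i j, (fun x => f i x * f j x) =
      fun x => ∏ k, obsDensity α (m i) (x k) * obsDensity α (m j) (x k) := fun i j => by
    ext x
    simp only [hf, Finset.prod_mul_distrib]
  have hffi : ∀ i j, Integrable (fun x => f i x * f j x) P := fun i j => by
    rw [hff]
    exact Integrable.fintype_prod (f := fun _ p => obsDensity α (m i) p * obsDensity α (m j) p)
      fun _ => (integrable_and_integral_obsDensity_mul α (m i) (m j)).1
  have hff1 : ∀ i j, ∫ x, f i x * f j x ∂P = (Real.cosh (inner ℝ (m i) (m j)) +
      α ^ 2 * Real.sinh (inner ℝ (m i) (m j))) ^ n := fun i j => by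
    rw [hff, hP, integral_fintype_prod_eq_prod
      (fun _ p => obsDensity α (m i) p * obsDensity α (m j) p)]
    simp [(integrable_and_integral_obsDensity_mul α (m i) (m j)).2]
  set L : (Fin n → Fin 2 × EuclideanSpace ℝ (Fin d)) → ℝ := fun x => ∑ i, c⁻¹ * f i x with hL
  have hLsq : ∀ x, L x ^ 2 = ∑ i, ∑ j, (c ^ 2)⁻¹ * (f i x * f j x) := fun x => by
    simp only [hL]
    rw [sq, Finset.sum_mul_sum]
    refine Finset.sum_congr rfl fun i _ => Finset.sum_congr rfl fun j _ => ?_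
    rw [← inv_pow]
    ring
  have hA : MeasurableSet {x | φ x = 1} := hφ (measurableSet_singleton 1)
  have hcompl : {x | φ x = 0} = {x | φ x = 1}ᶜ := by
    ext x
    simp only [Set.mem_ofPred_eq, Set.mem_compl_iff]
    lia
  refine (one_sub_le_testing_error (P := P) (L := L)
    (fun x => Finset.sum_nonneg fun i _ => mul_nonneg (inv_nonneg.2 hc0.le) (hf0 i x))
    (integrable_finsetSum _ fun i _ => (hfi i).const_mul _) ?_ ?_ hε ?_ hA).trans
    (add_le_add ?_ ?_)
  · rw [integral_finsetSum _ fun i _ => (hfi i).const_mul _]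
    simp [integral_const_mul, hf1, ← hc, hc0.ne']
  · simp_rw [hLsq]
    exact integrable_finsetSum _ fun i _ => integrable_finsetSum _ fun j _ =>
      (hffi i j).const_mul _
  · simp_rw [hLsq]
    rw [integral_finsetSum _ fun i _ => integrable_finsetSum _ fun j _ =>
      (hffi i j).const_mul _]
    simp_rw [integral_finsetSum _ fun j _ => (hffi _ j).const_mul _, integral_const_mul, hff1,
      ← Finset.mul_sum]
    rw [inv_mul_le_iff₀ (by positivity)]
    exact hchi
  · refine le_trans (le_of_eq ?_) (le_iSup₂ (f := fun θ (_ : θ ∈ G₀) =>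
      sampleLaw n θ {x | φ x = 1}) _ h₀)
    rw [sampleLaw, obsLaw_oppositeMeans_zero hα]
  · rw [← hcompl, withDensity_apply _ (hcompl ▸ hA.compl)]
    have hLe : ∀ x, ENNReal.ofReal (L x) =
        ∑ i, ENNReal.ofReal c⁻¹ * ENNReal.ofReal (f i x) := fun x => by
      rw [hL, ENNReal.ofReal_sum_of_nonneg fun i _ => mul_nonneg (inv_nonneg.2 hc0.le) (hf0 i x)]
      exact Finset.sum_congr rfl fun i _ => ENNReal.ofReal_mul (inv_nonneg.2 hc0.le)
    simp_rw [hLe]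
    rw [lintegral_finsetSum' _ fun i _ =>
      ((hfi i).1.aemeasurable.ennreal_ofReal.const_mul _).restrict]
    calc ∑ i, ∫⁻ x in {x | φ x = 0}, ENNReal.ofReal c⁻¹ * ENNReal.ofReal (f i x) ∂P
        = ∑ i, ENNReal.ofReal c⁻¹ * sampleLaw n (oppositeMeans α (m i)) {x | φ x = 0} := by
          refine Finset.sum_congr rfl fun i _ => ?_
          rw [lintegral_const_mul' _ _ ENNReal.ofReal_ne_top, sampleLaw_eq_withDensity n hα,
            withDensity_apply _ (hcompl ▸ hA.compl)]
      _ ≤ ∑ _i : ι, ENNReal.ofReal c⁻¹ * ⨆ θ ∈ G₁, sampleLaw n θ {x | φ x = 0} := by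
          gcongr with i
          exact le_iSup₂ (f := fun θ (_ : θ ∈ G₁) => sampleLaw n θ {x | φ x = 0}) _ (h₁ i)
      _ = ⨆ θ ∈ G₁, sampleLaw n θ {x | φ x = 0} := by
          rw [Finset.sum_const, Finset.card_univ, nsmul_eq_mul, ← mul_assoc,
            ENNReal.ofReal_inv_of_pos hc0, hc, ENNReal.ofReal_natCast,
            ENNReal.mul_inv_cancel (by simp) (by simp), one_mul]

/-! ### The trivial upper bound -/

lemma isProbabilityMeasure_sampleLaw {d : ℕ} (n : ℕ) {θ : Param d}
    (hα : θ.alpha ∈ Set.Icc (0 : ℝ) 1) : IsProbabilityMeasure (sampleLaw n θ) := by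
  have hlabel : ∀ z, IsProbabilityMeasure (labelLaw θ.alpha z) := fun z => by
    refine ⟨?_⟩
    obtain ⟨h0, h1⟩ := hα
    simp only [labelLaw, Measure.add_apply, Measure.smul_apply, measure_univ, smul_eq_mul, mul_one]
    rw [← ENNReal.ofReal_add (by linarith) (by linarith)]
    convert ENNReal.ofReal_one
    ring
  have : IsProbabilityMeasure (obsLaw θ) := by
    refine ⟨?_⟩
    rw [obsLaw, Measure.finsetSum_apply]
    simp [ENNReal.mul_inv_cancel]
  unfold sampleLaw
  infer_instance

lemma minimaxRisk_le_one {d : ℕ} (n : ℕ) {α : ℝ} (hα : α ∈ Set.Icc (0 : ℝ) 1)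
    (S : Matrix (Fin d) (Fin d) ℝ) (G₁ : Set (Param d)) :
    minimaxRisk n (nullSpace S α) G₁ ≤ 1 := by
  refine (iInf₂_le (fun _ => 1) measurable_const).trans ?_
  rw [risk]
  simp only [Set.ofPred_true, one_ne_zero, Set.ofPred_false, measure_empty, ENNReal.iSup_zero,
    add_zero]
  refine iSup₂_le fun θ hθ => ?_
  have := isProbabilityMeasure_sampleLaw n (θ := θ) (hθ.2.2 ▸ hα)
  exact prob_le_one

/-! ### The sparse block prior -/

/-- The vector encoded by `f`: the first `s * b` coordinates are cut into `s` blocks of length `b`,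
and the vector has the entry `c` at position `f i` of the block `i`, and zeros elsewhere. -/
noncomputable def sparseMean {s b d : ℕ} (h : s * b ≤ d) (c : ℝ) (f : Fin s → Fin b) :
    EuclideanSpace ℝ (Fin d) :=
  ∑ i, EuclideanSpace.single (Fin.castLE h (finProdFinEquiv (i, f i))) c

/-- The number of blocks in which two selections agree. -/
def agreements {s b : ℕ} (f g : Fin s → Fin b) : ℕ := (Finset.univ.filter fun i => f i = g i).card

lemma agreements_le {s b : ℕ} (f g : Fin s → Fin b) : agreements f g ≤ s :=
  (Finset.card_filter_le _ _).trans (by simp)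

lemma agreements_self {s b : ℕ} (f : Fin s → Fin b) : agreements f f = s := by
  simp [agreements]

lemma inner_sparseMean {s b d : ℕ} (h : s * b ≤ d) (c : ℝ) (f g : Fin s → Fin b) :
    inner ℝ (sparseMean h c f) (sparseMean h c g) = c ^ 2 * agreements f g := by
  have hij : ∀ i j, inner ℝ
      (EuclideanSpace.single (Fin.castLE h (finProdFinEquiv (i, f i))) c : EuclideanSpace ℝ (Fin d))
      (EuclideanSpace.single (Fin.castLE h (finProdFinEquiv (j, g j))) c) =
      if i = j then (if f i = g i then c ^ 2 else 0) else 0 := by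
    intro i j
    rw [EuclideanSpace.inner_single_left, PiLp.single_apply]
    by_cases hi : i = j
    · subst hi
      by_cases hf : f i = g i <;> simp [hf, sq]
    · simp [hi]
  simp_rw [sparseMean, sum_inner, inner_sum, hij]
  simp [agreements, mul_comm, Finset.sum_ite]

lemma hammingNorm_sparseMean_le {s b d : ℕ} (h : s * b ≤ d) (c : ℝ) (f : Fin s → Fin b) (a : ℝ) :
    hammingNorm (a • sparseMean h c f).ofLp ≤ s := by
  classical
  have hsub : (Finset.univ.filter fun j => (a • sparseMean h c f).ofLp j ≠ 0) ⊆
      Finset.univ.image fun i => Fin.castLE h (finProdFinEquiv (i, f i)) := by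
    intro j hj
    by_contra hcon
    refine (Finset.mem_filter.1 hj).2 ?_
    have : ∀ i, j ≠ Fin.castLE h (finProdFinEquiv (i, f i)) := by
      rintro i rfl
      exact hcon (Finset.mem_image_of_mem _ (Finset.mem_univ i))
    simp [sparseMean, this]
  exact (Finset.card_le_card hsub).trans (Finset.card_image_le.trans (by simp))

lemma oppositeMeans_sparseMean_mem_altSpace {s b d : ℕ} (h : s * b ≤ d) {c α γ : ℝ}
    (hγ : γ ≤ 4 * c ^ 2 * s) (f : Fin s → Fin b) :
    oppositeMeans α (sparseMean h c f) ∈ altSpace 1 α s γ := by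
  have hdiff : (oppositeMeans α (sparseMean h c f)).mean 0 -
      (oppositeMeans α (sparseMean h c f)).mean 1 = (2 : ℝ) • sparseMean h c f := by
    simp [oppositeMeans, labelSign, two_smul]
  refine ⟨?_, ?_, rfl, rfl⟩
  · rw [hdiff]
    exact hammingNorm_sparseMean_le h c f 2
  · have hin : snr (oppositeMeans α (sparseMean h c f)) =
        inner ℝ ((2 : ℝ) • sparseMean h c f) ((2 : ℝ) • sparseMean h c f) := by
      rw [snr, hdiff, EuclideanSpace.inner_eq_star_dotProduct]
      simp [oppositeMeans]
    rw [hin, inner_smul_left, inner_smul_right, inner_sparseMean, agreements_self]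
    simp only [conj_trivial]
    linarith

/-! ### Bounds on the second moment -/

lemma sinh_le_mul_cosh {t : ℝ} (ht : 0 ≤ t) : Real.sinh t ≤ t * Real.cosh t := by
  have hmono : MonotoneOn (fun t => t * Real.cosh t - Real.sinh t) (Set.Ici 0) := by
    refine monotoneOn_of_hasDerivWithinAt_nonneg (convex_Ici 0)
      (f' := fun t => t * Real.sinh t) (by fun_prop) (fun x _ => ?_) fun x hx => ?_
    · have := ((hasDerivAt_id x).mul (Real.hasDerivAt_cosh x)).sub (Real.hasDerivAt_sinh x)
      refine HasDerivAt.hasDerivWithinAt ?_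
      convert! this using 1
      simp
    · rw [interior_Ici] at hx
      exact mul_nonneg hx.le (Real.sinh_nonneg_iff.2 hx.le)
  have := hmono Set.self_mem_Ici ht ht
  simp at this
  exact this

lemma cosh_add_mul_sinh_le_exp {a t : ℝ} (ha : 0 ≤ a) (ht : 0 ≤ t) :
    Real.cosh t + a * Real.sinh t ≤ Real.exp (t ^ 2 / 2 + a * t) := by
  calc Real.cosh t + a * Real.sinh t ≤ Real.cosh t * (a * t + 1) := by
        nlinarith [mul_le_mul_of_nonneg_left (sinh_le_mul_cosh ht) ha]
    _ ≤ Real.exp (t ^ 2 / 2) * Real.exp (a * t) := by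
        gcongr
        · exact Real.cosh_le_exp_half_sq t
        · exact Real.add_one_le_exp _
    _ = _ := (Real.exp_add _ _).symm

/-- Up to normalization, the probability generating function of `Bin (s, 1 / b)`, the law of the
number of agreements of two independent uniform selections. -/
lemma sum_pow_agreements {s b : ℕ} (x : ℝ) :
    ∑ f : Fin s → Fin b, ∑ g : Fin s → Fin b, x ^ agreements f g =
      ((b : ℝ) * (b - 1 + x)) ^ s := by
  have hx : ∀ f g : Fin s → Fin b, x ^ agreements f g = ∏ i, if f i = g i then x else 1 := by
    intro f g
    simp [agreements, Finset.prod_ite]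
  simp_rw [hx]
  have hg : ∀ f : Fin s → Fin b,
      ∑ g : Fin s → Fin b, ∏ i, (if f i = g i then x else 1) = (b - 1 + x) ^ s := by
    intro f
    rw [← Fintype.prod_sum fun i a => if f i = a then x else 1]
    have : ∀ c : Fin b, ∑ a, (if c = a then x else 1) = b - 1 + x := by
      intro c
      have : ∀ a, (if c = a then x else 1) = 1 + if c = a then x - 1 else 0 := by
        intro a; split_ifs <;> ring
      simp_rw [this, Finset.sum_add_distrib]
      simp
      ring
    simp [this]
  simp [hg, mul_pow]

lemma sum_pow_agreements_le {s b : ℕ} (hb : 0 < b) {x : ℝ} (hx : 0 ≤ x) :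
    ∑ f : Fin s → Fin b, ∑ g : Fin s → Fin b, x ^ agreements f g ≤
      (Fintype.card (Fin s → Fin b) : ℝ) ^ 2 * Real.exp (s * (x / b)) := by
  have hb' : (1 : ℝ) ≤ b := Nat.one_le_cast.2 hb
  rw [sum_pow_agreements, Real.exp_nat_mul, Fintype.card_pi]
  simp only [Fintype.card_fin, Finset.prod_const, Finset.card_univ]
  rw [Nat.cast_pow, ← pow_mul, mul_comm s 2, pow_mul, ← mul_pow]
  refine pow_le_pow_left₀ (by nlinarith) ?_ _
  calc (b : ℝ) * (b - 1 + x) ≤ b ^ 2 * (x / b + 1) := by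
        have : (b : ℝ) ^ 2 * (x / b) = b * x := by field_simp
        nlinarith
    _ ≤ _ := by gcongr; exact Real.add_one_le_exp _

/-- The exponent in the bound on the correlation of `n` observations, for two means with `K`
agreements, whose inner product is `γ / (4 * s) * K`, is at most `K * (η * l)`; here `a` stands for
`α ^ 2` and `l` for `log d`. -/
lemma exponent_le {n s K : ℕ} {a γ η l : ℝ} (hs : 0 < s) (hK : K ≤ s) (hη0 : 0 ≤ η) (hη : η ≤ 1)
    (hl : 0 ≤ l) (h₁ : n * γ ^ 2 ≤ η ^ 2 * (s * l)) (h₂ : n * (a * γ) ≤ η * (s * l)) :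
    n * ((γ / (4 * s) * K) ^ 2 / 2 + a * (γ / (4 * s) * K)) ≤ K * (η * l) := by
  have hs' : (0 : ℝ) < s := Nat.cast_pos.2 hs
  have hK' : (K : ℝ) ≤ s := Nat.cast_le.2 hK
  have e1 : n * ((γ / (4 * s) * K) ^ 2 / 2) ≤ K * (η * l) / 2 := by
    calc n * ((γ / (4 * s) * K) ^ 2 / 2) = (n * γ ^ 2) * (K ^ 2 / (32 * s ^ 2)) := by
          field_simp; ring
      _ ≤ (η ^ 2 * (s * l)) * (K ^ 2 / (32 * s ^ 2)) := by gcongr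
      _ = (K * (η * l)) * (η * (K / s) / 32) := by field_simp
      _ ≤ (K * (η * l)) * (1 * 1 / 32) := by
          gcongr
          exact (div_le_one hs').2 hK'
      _ ≤ _ := by
          have : 0 ≤ K * (η * l) := by positivity
          linarith
  have e2 : n * (a * (γ / (4 * s) * K)) ≤ K * (η * l) / 2 := by
    calc n * (a * (γ / (4 * s) * K)) = n * (a * γ) * (K / (4 * s)) := by ring
      _ ≤ η * (s * l) * (K / (4 * s)) := by gcongr
      _ = K * (η * l) / 4 := by field_simp
      _ ≤ _ := by
          have : 0 ≤ K * (η * l) := by positivity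
          linarith
  linarith

lemma exp_le_one_add_two_mul {x : ℝ} (h0 : 0 ≤ x) (hx : x ≤ 1 / 2) : Real.exp x ≤ 1 + 2 * x := by
  refine (Real.exp_bound_div_one_sub_of_interval h0 (by linarith)).trans ?_
  rw [div_le_iff₀ (by linarith)]
  nlinarith

/-- The bound on the expected number of agreements, of order `s ^ 2 / d`, weighted by `d ^ η`. -/
lemma sq_mul_rpow_div_le {d s : ℕ} {η δ : ℝ} (hd : 0 < d) (hη : η ≤ 2 * δ)
    (hsd : s ≤ η * (d : ℝ) ^ (1 / 2 - δ)) :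
    (s : ℝ) ^ 2 * (d : ℝ) ^ η / d ≤ η ^ 2 := by
  have hd0 : (0 : ℝ) < d := Nat.cast_pos.2 hd
  have hd1 : (1 : ℝ) ≤ d := Nat.one_le_cast.2 hd
  calc (s : ℝ) ^ 2 * (d : ℝ) ^ η / d ≤ (η * (d : ℝ) ^ (1 / 2 - δ)) ^ 2 * (d : ℝ) ^ η / d := by
        gcongr
    _ = η ^ 2 * (d : ℝ) ^ (η - 2 * δ) := by
        rw [mul_pow, ← Real.rpow_mul_natCast hd0.le, mul_assoc, mul_div_assoc,
          ← Real.rpow_add hd0, ← Real.rpow_sub_one hd0.ne']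
        congr 2
        push_cast
        ring
    _ ≤ η ^ 2 * 1 := by
        gcongr
        exact Real.rpow_le_one_of_one_le_of_nonpos hd1 (by linarith)
    _ = _ := mul_one _

/-! ### Lower bound at the minimax rate -/

lemma one_sub_le_minimaxRisk_altSpace {d s n : ℕ} {α γ η δ : ℝ} (hα : α ∈ Set.Icc (0 : ℝ) 1)
    (hs : 0 < s) (hγ : 0 ≤ γ) (hη0 : 0 < η) (hη : η ≤ 1 / 2) (hδ : 0 < δ) (hηδ : η ≤ 2 * δ)
    (hsd : s ≤ η * (d : ℝ) ^ (1 / 2 - δ))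
    (h₁ : n * γ ^ 2 ≤ η ^ 2 * (s * Real.log d)) (h₂ : n * (α ^ 2 * γ) ≤ η * (s * Real.log d)) :
    ENNReal.ofReal (1 - 2 * η) ≤ minimaxRisk n (nullSpace (d := d) 1 α) (altSpace 1 α s γ) := by
  have hs' : (1 : ℝ) ≤ s := Nat.one_le_cast.2 hs
  -- For `d = 0` the power `0 ^ (1 / 2 - δ)` is still at most `1`, also when the exponent is `0` or
  -- negative.
  have hd : 0 < d := by
    rw [Nat.pos_iff_ne_zero]
    rintro rfl
    have : ((0 : ℕ) : ℝ) ^ (1 / 2 - δ) ≤ 1 := by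
      rw [Nat.cast_zero]
      exact Real.zero_rpow_le_one _
    nlinarith
  have hd0 : (0 : ℝ) < d := Nat.cast_pos.2 hd
  have hd1 : (1 : ℝ) ≤ d := Nat.one_le_cast.2 hd
  have hsled : s ≤ d := by
    have : (d : ℝ) ^ (1 / 2 - δ) ≤ (d : ℝ) ^ (1 : ℝ) :=
      Real.rpow_le_rpow_of_exponent_le hd1 (by linarith)
    rw [Real.rpow_one] at this
    have : (s : ℝ) ≤ d := by nlinarith
    exact_mod_cast this
  set b := d / s with hb
  have hb0 : 0 < b := Nat.div_pos hsled hs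
  have hsb : s * b ≤ d := Nat.mul_div_le d s
  have hdb : (d : ℝ) ≤ 2 * s * b := by
    have h1 : d < s * (b + 1) := Nat.lt_mul_div_succ d hs
    have h2 : d ≤ 2 * s * b := by nlinarith
    exact_mod_cast h2
  have : Nonempty (Fin b) := ⟨⟨0, hb0⟩⟩
  set c : ℝ := √(γ / (4 * s)) with hc
  have hc2 : c ^ 2 = γ / (4 * s) := Real.sq_sqrt (by positivity)
  have hl : 0 ≤ Real.log d := Real.log_natCast_nonneg d
  refine one_sub_le_minimaxRisk hα (fun f : Fin s → Fin b => sparseMean hsb c f)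
    (by simp [nullSpace, oppositeMeans])
    (oppositeMeans_sparseMean_mem_altSpace hsb (by rw [hc2]; field_simp; rfl))
    (mul_pos two_pos hη0) ?_
  calc _ ≤ ∑ f : Fin s → Fin b, ∑ g : Fin s → Fin b, ((d : ℝ) ^ η) ^ agreements f g := by
        refine Finset.sum_le_sum fun f _ => Finset.sum_le_sum fun g _ => ?_
        have ht : 0 ≤ γ / (4 * s) * (agreements f g : ℝ) := by positivity
        rw [inner_sparseMean, hc2]
        refine (pow_le_pow_left₀ (add_nonneg (Real.cosh_pos _).le
          (mul_nonneg (sq_nonneg _) (Real.sinh_nonneg_iff.2 ht)))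
          (cosh_add_mul_sinh_le_exp (sq_nonneg α) ht) n).trans ?_
        rw [← Real.exp_nat_mul, Real.rpow_def_of_pos hd0, ← Real.exp_nat_mul]
        refine Real.exp_le_exp.2 ?_
        rw [mul_comm (Real.log d)]
        exact exponent_le hs (agreements_le f g) hη0.le (by linarith) hl h₁ h₂
    _ ≤ (Fintype.card (Fin s → Fin b) : ℝ) ^ 2 * Real.exp (s * ((d : ℝ) ^ η / b)) :=
        sum_pow_agreements_le hb0 (by positivity)
    _ ≤ (Fintype.card (Fin s → Fin b) : ℝ) ^ 2 * (1 + (2 * η) ^ 2) := by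
        have hexp : s * ((d : ℝ) ^ η / b) ≤ 2 * η ^ 2 := by
          have hb1 : (0 : ℝ) < b := Nat.cast_pos.2 hb0
          calc s * ((d : ℝ) ^ η / b) = s * (d : ℝ) ^ η * (1 / b) := by ring
            _ ≤ s * (d : ℝ) ^ η * (2 * s / d) := by
                gcongr s * (d : ℝ) ^ η * ?_
                rw [div_le_div_iff₀ hb1 hd0]
                linarith
            _ = 2 * (s ^ 2 * (d : ℝ) ^ η / d) := by ring
            _ ≤ _ := by gcongr; exact sq_mul_rpow_div_le hd hηδ hsd
        gcongr
        refine (Real.exp_le_exp.2 hexp).trans ((exp_le_one_add_two_mul (by positivity) ?_).trans ?_)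
        · nlinarith
        · linarith

/-- At signal strength zero the null with both means `0` lies in the alternative as well. -/
lemma one_le_minimaxRisk_of_nonpos {d s n : ℕ} {α γ : ℝ} (hα : α ∈ Set.Icc (0 : ℝ) 1)
    (hγ : γ ≤ 0) : 1 ≤ minimaxRisk n (nullSpace (d := d) 1 α) (altSpace 1 α s γ) := by
  have hmem : oppositeMeans α (0 : EuclideanSpace ℝ (Fin d)) ∈ altSpace 1 α s γ := by
    refine ⟨?_, ?_, rfl, rfl⟩ <;> simp [oppositeMeans, snr, hγ]
  refine le_iInf₂ fun φ hφ => ?_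
  have := isProbabilityMeasure_sampleLaw n (θ := oppositeMeans α (0 : EuclideanSpace ℝ (Fin d))) hα
  have hcompl : {x | φ x = 0} = {x | φ x = 1}ᶜ := by
    ext x
    simp only [Set.mem_ofPred_eq, Set.mem_compl_iff]
    lia
  rw [← prob_add_prob_compl (μ := sampleLaw n (oppositeMeans α (0 : EuclideanSpace ℝ (Fin d))))
    (hφ (measurableSet_singleton 1))]
  refine add_le_add ?_ ?_
  · exact le_iSup₂ (f := fun θ (_ : θ ∈ nullSpace 1 α) => sampleLaw n θ {x | φ x = 1}) _
      (by simp [nullSpace, oppositeMeans])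
  · rw [hcompl]
    exact le_iSup₂ (f := fun θ (_ : θ ∈ altSpace 1 α s γ) => sampleLaw n θ {x | φ x = 1}ᶜ) _ hmem

lemma sample_bounds_of_le_rate {n d s : ℕ} {α γ η : ℝ} (hγ : 0 ≤ γ) (hη0 : 0 ≤ η)
    (h : γ ≤ η * rate n d s α) :
    n * γ ^ 2 ≤ η ^ 2 * (s * Real.log d) ∧ n * (α ^ 2 * γ) ≤ η * (s * Real.log d) := by
  have hl : 0 ≤ s * Real.log d := mul_nonneg s.cast_nonneg (Real.log_natCast_nonneg d)
  rcases n.eq_zero_or_pos with rfl | hn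
  · simp only [Nat.cast_zero, zero_mul]
    exact ⟨by positivity, by positivity⟩
  have hn' : (0 : ℝ) < n := Nat.cast_pos.2 hn
  have hrate : rate n d s α ≤ √(s * Real.log d / n) := by
    unfold rate
    split_ifs
    exacts [le_rfl, min_le_left _ _]
  constructor
  · calc n * γ ^ 2 ≤ n * (η * √(s * Real.log d / n)) ^ 2 := by
          gcongr
          exact h.trans (by gcongr)
      _ = _ := by
          rw [mul_pow, Real.sq_sqrt (by positivity)]
          field_simp
  · rcases eq_or_ne α 0 with rfl | hα
    · simp only [ne_eq, OfNat.ofNat_ne_zero, not_false_eq_true, zero_pow, zero_mul, mul_zero]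
      positivity
    · have : rate n d s α ≤ 1 / α ^ 2 * (s * Real.log d / n) := by
        rw [rate, if_neg hα]
        exact min_le_right _ _
      calc n * (α ^ 2 * γ) ≤ n * (α ^ 2 * (η * (1 / α ^ 2 * (s * Real.log d / n)))) := by
            gcongr
            exact h.trans (by gcongr)
        _ = _ := by field_simp

lemma rate_nonneg (n d s : ℕ) (α : ℝ) : 0 ≤ rate n d s α := by
  have hl : 0 ≤ s * Real.log d := mul_nonneg s.cast_nonneg (Real.log_natCast_nonneg d)
  unfold rate
  split_ifs
  · positivity
  · exact le_min (by positivity) (by positivity)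

end WeakSup


theorem theorem1 (d s : ℕ → ℕ) (α γ : ℕ → ℝ)
    (hα : ∀ n, α n ∈ Set.Icc (0 : ℝ) 1)
    (hs : ∃ δ : ℝ, 0 < δ ∧
      (fun n => (s n : ℝ)) =o[atTop] fun n => (d n : ℝ) ^ (1 / 2 - δ))
    (hγ_nonneg : ∀ n, 0 ≤ γ n)
    (hγ : γ =o[atTop] fun n => WeakSup.rate n (d n) (s n) (α n)) :
    Tendsto
      (fun n => ⨆ (S : Matrix (Fin (d n)) (Fin (d n)) ℝ) (_ : S.PosDef),
        WeakSup.minimaxRisk n (WeakSup.nullSpace S (α n))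
          (WeakSup.altSpace S (α n) (s n) (γ n)))
      atTop (𝓝 1) := by
  obtain ⟨δ, hδ, hs⟩ := hs
  refine tendsto_order.2 ⟨fun a ha => ?_, fun a ha => Eventually.of_forall fun n =>
    (iSup₂_le fun S _ => WeakSup.minimaxRisk_le_one n (hα n) S _).trans_lt ha⟩
  obtain ⟨r, hr0, rfl⟩ : ∃ r : ℝ, 0 ≤ r ∧ ENNReal.ofReal r = a :=
    ⟨a.toReal, ENNReal.toReal_nonneg, ENNReal.ofReal_toReal ha.ne_top⟩
  have hr : r < 1 := by simpa using ha
  set η : ℝ := min (1 / 2) (min (2 * δ) ((1 - r) / 4)) with hη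
  have hη0 : 0 < η := lt_min (by norm_num) (lt_min (by linarith) (by linarith))
  have hη1 : η ≤ 1 / 2 := min_le_left _ _
  have hη2 : η ≤ 2 * δ := (min_le_right _ _).trans (min_le_left _ _)
  have hη3 : η ≤ (1 - r) / 4 := (min_le_right _ _).trans (min_le_right _ _)
  filter_upwards [hs.def hη0, hγ.def hη0] with n hsn hγn
  rw [Real.norm_of_nonneg (Nat.cast_nonneg _),
    Real.norm_of_nonneg (Real.rpow_nonneg (Nat.cast_nonneg _) _)] at hsn
  rw [Real.norm_of_nonneg (hγ_nonneg n), Real.norm_of_nonneg (WeakSup.rate_nonneg _ _ _ _)] at hγn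
  have hlt : ENNReal.ofReal r < ENNReal.ofReal (1 - 2 * η) :=
    (ENNReal.ofReal_lt_ofReal_iff (by linarith)).2 (by linarith)
  refine hlt.trans_le (le_trans ?_ (le_iSup₂ (f := fun (S : Matrix (Fin (d n)) (Fin (d n)) ℝ)
    (_ : S.PosDef) => WeakSup.minimaxRisk n (WeakSup.nullSpace S (α n))
      (WeakSup.altSpace S (α n) (s n) (γ n))) 1 Matrix.PosDef.one))
  rcases (s n).eq_zero_or_pos with h0 | hpos
  -- For `s = 0` the rate vanishes, and with it `γ`.
  · refine le_trans ?_ (WeakSup.one_le_minimaxRisk_of_nonpos (hα n) ?_)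
    · exact ENNReal.ofReal_le_one.2 (by linarith)
    · have : WeakSup.rate n (d n) (s n) (α n) = 0 := by simp [WeakSup.rate, h0]
      simpa [this] using hγn
  · obtain ⟨h₁, h₂⟩ := WeakSup.sample_bounds_of_le_rate (hγ_nonneg n) hη0.le hγn
    exact WeakSup.one_sub_le_minimaxRisk_altSpace (hα n) hpos (hγ_nonneg n) hη0 hη1 hδ hη2 hsn
      h₁ h₂
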